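/- **Theorem 4.6.** Let $(X,\Sigma)$ be a measurable space and let $p(x,E)$, $x\in X$, $E\in\Sigma$, be the transition function of an arbitrary Markov chain on it: $p(x,\cdot)$ is a countably additive probability measure on $\Sigma$ for every $x\in X$, and $p(\cdot,E)$ is $\Sigma$-measurable for every $E\in\Sigma$. Let $p^k$ denote the $k$-step transition function, i.e. $p^1=p$ and $p^{k+1}(x,E)=\int_X p^k(y,E)\,p(x,dy)$, and for $m\ge 1$ let $$q_m(x,E)=\frac1m\sum_{k=1}^m p^k(x,E)$$ be the transition function of the Cesàro-averaged chain. Then the following two conditions are equivalent. $(D)$ There exist a finite (nonnegative, countably additive) measure $\varphi$ on $\Sigma$, a number $\varepsilon>0$ and an integer $k\ge 1$ such that for every $E\in\Sigma$ with $\varphi(E)\le\varepsilon$ one has $p^k(x,E)\le 1-\varepsilon$ for all $x\in X$. $(\tilde D)$ There exist a finite (nonnegative, countably additive) measure $\varphi$ on $\Sigma$, a number $\varepsilon>0$ and an integer $m\ge 1$ such that for every $E\in\Sigma$ with $\varphi(E)<\varepsilon$ one has $q_m(x,E)\le 1-\varepsilon$ for all $x\in X$. -/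

import Mathlib

open MeasureTheory ProbabilityTheory
open scoped ENNReal

namespace MarkovChain

variable {X : Type*} [MeasurableSpace X]

/-- The transition function `q_m = (1/m) ∑_{k=1}^m p^k` of the Cesàro-averaged chain. Here
`p ^ k` is the `k`-th iterate of `p` under composition (integral convolution) of kernels. -/
noncomputable def cesaroAverage (p : Kernel X X) (m : ℕ) : Kernel X X where
  toFun x := (m : ℝ≥0∞)⁻¹ • ∑ k ∈ Finset.Icc 1 m, (p ^ k) x
  measurable' := by
    refine Measure.measurable_of_measurable_coe _ fun E hE => ?_
    simp only [Measure.smul_apply, Measure.finsetSum_apply, smul_eq_mul]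
    exact (Finset.measurable_sum _ fun k _ => (p ^ k).measurable_coe hE).const_mul _

/-- The classical Doeblin condition `(D)`: there are a bounded nonnegative countably additive
measure `φ`, an `ε > 0` and an integer `k ≥ 1` such that `φ(E) ≤ ε` implies
`p^k(x, E) ≤ 1 - ε` for all `x`. -/
def DoeblinCondition (p : Kernel X X) : Prop :=
  ∃ (φ : Measure X) (ε : ℝ) (k : ℕ), IsFiniteMeasure φ ∧ 0 < ε ∧ 1 ≤ k ∧
    ∀ E : Set X, MeasurableSet E → φ.real E ≤ ε → ∀ x : X, ((p ^ k) x).real E ≤ 1 - ε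

/-- The averaged Doeblin condition `(D̃)`: there are a bounded nonnegative countably additive
measure `φ`, an `ε > 0` and an integer `m ≥ 1` such that `φ(E) < ε` implies
`q_m(x, E) ≤ 1 - ε` for all `x`. -/
def AveragedDoeblinCondition (p : Kernel X X) : Prop :=
  ∃ (φ : Measure X) (ε : ℝ) (m : ℕ), IsFiniteMeasure φ ∧ 0 < ε ∧ 1 ≤ m ∧
    ∀ E : Set X, MeasurableSet E → φ.real E < ε → ∀ x : X,
      (cesaroAverage p m x).real E ≤ 1 - ε

end MarkovChain

namespace MarkovChain

variable {X : Type*} [MeasurableSpace X]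

/-! Only (D̃) ⇒ (D) needs an idea: a small average yields a good time `j ≤ m` that depends on `x`,
whereas (D) wants one time for all `x`. Let `B` be the `likelySet` of `E`. It is `φ`-small when `E`
is small for `sumIterates`, so some `j` has `p^j(x,B) ≤ 1 - ε`. As `B` covers every remaining time
`m - j`, Chapman–Kolmogorov gives `p^m(x,E) ≤ 1 - ε/2` at the common time `m`. -/

theorem isMarkovKernel_pow (p : Kernel X X) [IsMarkovKernel p] (n : ℕ) :
    IsMarkovKernel (p ^ n) := by
  induction n with
  | zero => exact inferInstanceAs (IsMarkovKernel (Kernel.id : Kernel X X))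
  | succ n ih =>
    rw [pow_succ]
    exact inferInstanceAs (IsMarkovKernel ((p ^ n) ∘ₖ p))

theorem cesaroAverage_real_apply (p : Kernel X X) [IsMarkovKernel p] (m : ℕ) (x : X)
    (E : Set X) :
    (cesaroAverage p m x).real E
      = (m : ℝ)⁻¹ * ∑ k ∈ Finset.Icc 1 m, ((p ^ k) x).real E := by
  have := isMarkovKernel_pow p
  change ((m : ℝ≥0∞)⁻¹ • ∑ k ∈ Finset.Icc 1 m, (p ^ k) x).real E = _
  rw [measureReal_def, Measure.smul_apply, Measure.finsetSum_apply, smul_eq_mul,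
    ENNReal.toReal_mul, ENNReal.toReal_sum fun k _ => measure_ne_top _ _]
  simp [measureReal_def]

/-- If the Cesàro average gives a set mass at most `c`, then so does one of the averaged
transition functions. -/
theorem exists_pow_real_le_of_cesaroAverage_real_le (p : Kernel X X) [IsMarkovKernel p]
    {m : ℕ} (hm : 1 ≤ m) {x : X} {E : Set X} {c : ℝ}
    (h : (cesaroAverage p m x).real E ≤ c) :
    ∃ j ∈ Finset.Icc 1 m, ((p ^ j) x).real E ≤ c := by
  have hm0 : (0 : ℝ) < m := by exact_mod_cast hm
  refine Finset.exists_le_of_sum_le (Finset.nonempty_Icc.2 hm) ?_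
  rw [cesaroAverage_real_apply, inv_mul_le_iff₀ hm0] at h
  simpa using h

/-- Mass at most `1 - ε` for the last averaged transition function gives mass at most
`1 - ε / m` for the Cesàro average. -/
theorem cesaroAverage_real_le (p : Kernel X X) [IsMarkovKernel p] {m : ℕ} (hm : 1 ≤ m)
    {x : X} {E : Set X} {ε : ℝ} (h : ((p ^ m) x).real E ≤ 1 - ε) :
    (cesaroAverage p m x).real E ≤ 1 - ε / m := by
  have := isMarkovKernel_pow p
  obtain ⟨n, rfl⟩ : ∃ n, m = n + 1 := ⟨m - 1, by omega⟩
  have hm0 : (0 : ℝ) < (n + 1 : ℕ) := by positivity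
  rw [cesaroAverage_real_apply, inv_mul_le_iff₀ hm0, Finset.sum_Icc_succ_top (by omega)]
  have hsum : ∑ k ∈ Finset.Icc 1 n, ((p ^ k) x).real E ≤ n := by
    calc ∑ k ∈ Finset.Icc 1 n, ((p ^ k) x).real E ≤ ∑ _k ∈ Finset.Icc 1 n, (1 : ℝ) :=
          Finset.sum_le_sum fun k _ => measureReal_le_one
      _ = n := by simp
  have hmul : ((n + 1 : ℕ) : ℝ) * (1 - ε / (n + 1 : ℕ)) = n + 1 - ε := by
    field_simp
    push_cast
    ring
  linarith

/-- The sum of the first `m + 1` images of `φ` under the chain. -/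
noncomputable def sumIterates (p : Kernel X X) (φ : Measure X) (m : ℕ) : Measure X :=
  ∑ i ∈ Finset.range (m + 1), φ.bind ⇑(p ^ i : Kernel X X)

theorem isFiniteMeasure_sumIterates (p : Kernel X X) [IsMarkovKernel p] (φ : Measure X)
    [IsFiniteMeasure φ] (m : ℕ) : IsFiniteMeasure (sumIterates p φ m) := by
  have := isMarkovKernel_pow p
  unfold sumIterates
  infer_instance

/-- The points from which `E` has probability at least `1 / 2` after some `i ≤ m` steps. -/
def likelySet (p : Kernel X X) (m : ℕ) (E : Set X) : Set X :=
  ⋃ i ∈ Finset.range (m + 1), {y | (2 : ℝ≥0∞)⁻¹ ≤ (p ^ i) y E}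

theorem measurableSet_likelySet (p : Kernel X X) (m : ℕ) {E : Set X} (hE : MeasurableSet E) :
    MeasurableSet (likelySet p m E) :=
  Finset.measurableSet_biUnion _ fun i _ =>
    measurableSet_le measurable_const ((p ^ i).measurable_coe hE)

/-- Union bound over `i`, with Markov's inequality at level `1/2` for each `i`. -/
theorem measure_likelySet_le (p : Kernel X X) (φ : Measure X) (m : ℕ) {E : Set X}
    (hE : MeasurableSet E) : φ (likelySet p m E) ≤ 2 * sumIterates p φ m E := by
  rw [sumIterates, Measure.finsetSum_apply, Finset.mul_sum]
  refine (measure_biUnion_finset_le _ _).trans (Finset.sum_le_sum fun i _ => ?_)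
  rw [Measure.bind_apply hE (p ^ i).aemeasurable]
  have h := mul_meas_ge_le_lintegral (μ := φ) ((p ^ i).measurable_coe hE) (2 : ℝ≥0∞)⁻¹
  calc φ {y | (2 : ℝ≥0∞)⁻¹ ≤ (p ^ i) y E}
      = 2 * ((2 : ℝ≥0∞)⁻¹ * φ {y | (2 : ℝ≥0∞)⁻¹ ≤ (p ^ i) y E}) := by
        rw [← mul_assoc, ENNReal.mul_inv_cancel (by simp) (by simp), one_mul]
    _ ≤ _ := by gcongr

theorem measureReal_likelySet_le (p : Kernel X X) [IsMarkovKernel p] (φ : Measure X)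
    [IsFiniteMeasure φ] (m : ℕ) {E : Set X} (hE : MeasurableSet E) :
    φ.real (likelySet p m E) ≤ 2 * (sumIterates p φ m).real E := by
  have := isFiniteMeasure_sumIterates p φ m
  have h := ENNReal.toReal_mono (ENNReal.mul_ne_top (by simp) (measure_ne_top _ _))
    (measure_likelySet_le p φ m hE)
  simpa [measureReal_def] using h

/-- Chapman–Kolmogorov at time `j`: outside `likelySet p m E` the remaining `m - j` steps reach
`E` with probability at most `1 / 2`. -/
theorem pow_real_le_of_likelySet (p : Kernel X X) [IsMarkovKernel p] {j m : ℕ} (hj : j ≤ m)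
    {E : Set X} (hE : MeasurableSet E) (x : X) :
    ((p ^ m) x).real E ≤ 2⁻¹ + 2⁻¹ * ((p ^ j) x).real (likelySet p m E) := by
  have := isMarkovKernel_pow p
  have hB := measurableSet_likelySet p m hE
  have h : (p ^ m) x E ≤ 2⁻¹ + 2⁻¹ * (p ^ j) x (likelySet p m E) := by
    calc (p ^ m) x E = (p ^ (j + (m - j))) x E := by rw [Nat.add_sub_cancel' hj]
      _ = ∫⁻ y, (p ^ (m - j)) y E ∂((p ^ j) x) := by
        rw [add_comm, pow_add]
        exact Kernel.comp_apply' _ _ _ hE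
      -- The integrand is at most `1 = 1/2 + 1/2` on the likely set and below `1/2` off it.
      _ ≤ ∫⁻ y, (2⁻¹ + 2⁻¹ * (likelySet p m E).indicator 1 y) ∂((p ^ j) x) := by
        refine lintegral_mono fun y => ?_
        by_cases hy : y ∈ likelySet p m E
        · simpa [hy, ENNReal.inv_two_add_inv_two] using prob_le_one (μ := (p ^ (m - j)) y)
        · have hlt : ¬ (2 : ℝ≥0∞)⁻¹ ≤ (p ^ (m - j)) y E := fun hle =>
            hy (Set.mem_biUnion (Finset.mem_coe.2 (Finset.mem_range.2 (by omega))) hle)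
          simpa [hy] using (not_le.1 hlt).le
      _ = 2⁻¹ + 2⁻¹ * (p ^ j) x (likelySet p m E) := by
        rw [lintegral_add_left measurable_const, lintegral_const,
          lintegral_const_mul _ (measurable_one.indicator hB), lintegral_indicator_one hB]
        simp
  have hfin : (2 : ℝ≥0∞)⁻¹ * (p ^ j) x (likelySet p m E) ≠ ∞ :=
    ENNReal.mul_ne_top (by simp) (measure_ne_top _ _)
  have h' := ENNReal.toReal_mono (ENNReal.add_ne_top.2 ⟨by simp, hfin⟩) h
  rw [ENNReal.toReal_add (by simp) hfin, ENNReal.toReal_mul] at h'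
  simpa [measureReal_def] using h'

theorem DoeblinCondition.averaged {p : Kernel X X} [IsMarkovKernel p]
    (h : DoeblinCondition p) : AveragedDoeblinCondition p := by
  obtain ⟨φ, ε, k, hφ, hε, hk, h⟩ := h
  have hk1 : (1 : ℝ) ≤ k := by exact_mod_cast hk
  refine ⟨φ, ε / k, k, hφ, by positivity, hk, fun E hE hφE x => ?_⟩
  exact cesaroAverage_real_le p hk (h E hE (hφE.le.trans (div_le_self hε.le hk1)) x)

theorem AveragedDoeblinCondition.doeblin {p : Kernel X X} [IsMarkovKernel p]
    (h : AveragedDoeblinCondition p) : DoeblinCondition p := by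
  obtain ⟨φ, ε, m, hφ, hε, hm, h⟩ := h
  -- With `ε / 4` the likely set has `φ`-mass at most `ε / 2`, strictly below `ε` as (D̃) requires.
  refine ⟨sumIterates p φ m, ε / 4, m, isFiniteMeasure_sumIterates p φ m, by positivity, hm,
    fun E hE hφE x => ?_⟩
  have hB : φ.real (likelySet p m E) < ε := by
    linarith [measureReal_likelySet_le p φ m hE]
  obtain ⟨j, hj, hjB⟩ := exists_pow_real_le_of_cesaroAverage_real_le p hm
    (h _ (measurableSet_likelySet p m hE) hB x)
  linarith [pow_real_le_of_likelySet p (Finset.mem_Icc.1 hj).2 hE x]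

end MarkovChain

theorem theorem4p6 {X : Type*} [MeasurableSpace X] (p : Kernel X X) [IsMarkovKernel p] :
    MarkovChain.DoeblinCondition p ↔ MarkovChain.AveragedDoeblinCondition p :=
  ⟨fun h => h.averaged, fun h => h.doeblin⟩
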